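/- **Setting.** Let $p>3$ be a prime, $k$ a perfect field of characteristic $p$ with algebraic closure $\bar k$, $W=W(k)$ and $\overline W=W(\bar k)$ the rings of Witt vectors, $K^{\mathrm u}=\overline W[1/p]$, $A=W[[t_1,\dots,t_h]]$, $\overline A=\overline W[[t_1,\dots,t_h]]$, $A_0=A/pA=k[[t_1,\dots,t_h]]$. A *lift of Frobenius* on $A$ is a ring endomorphism $\phi$ that restricts to the Witt vector Frobenius $\sigma$ on $W$ and reduces to $a\mapsto a^p$ modulo $p$; similarly for $\overline A$. An *$F$-crystal over $A_0$* is a finitely generated free $A$-module $H$ with an integrable, $p$-adically topologically nilpotent connection $\nabla=\sum_j dt_j\otimes D_j$ and, for every lift of Frobenius $\phi$, a horizontal $A$-linear map $F(\phi):\phi^*H\to H$ which is an isomorphism after inverting $p$, such that the maps for different lifts are related by the Taylor formula $$F(\phi)\phi^*x=\sum_{m_1,\dots,m_h\ge0}\ \prod_j\frac{p^{m_j}}{m_j!}\Big(\frac{\phi(t_j)-\psi(t_j)}p\Big)^{m_j}F(\psi)\psi^*(D_1^{m_1}\cdots D_h^{m_h}x).$$ Put $H_0=H/pH$, $\mathrm{Fil}_iH_0=\{x: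 x\text{ has a lift }y\in H\text{ with }p^iy\in\mathrm{Im}\,F(\phi)\}$ and $\mathrm{Fil}^iH_0=\{x: x\text{ has a lift }y\in H\text{ with }F(\phi)\phi^*y\in p^iH\}$ (both are independent of $\phi$). $H$ is *ordinary* if $\mathrm{gr}_\bullet H_0$ is free over $A_0$ and $H_0=\mathrm{Fil}_iH_0\oplus\mathrm{Fil}^{i+1}H_0$ for all $i$; it is *of level $\le 3$* if $\mathrm{Fil}_3H_0=H_0$ and $\mathrm{Fil}^4H_0=0$. A *Hodge $F$-crystal* carries in addition a decreasing filtration $H=\mathrm{Fil}^0H\supset\mathrm{Fil}^1H\supset\cdots$ by free submodules with $\mathrm{Fil}^iH\otimes_AA_0=\mathrm{Fil}^iH_0$ and $D_j\mathrm{Fil}^{i+1}H\subset\mathrm{Fil}^{i}H$ for all $i,j$; it is *divisible* if $F(\phi)\phi^*\mathrm{Fil}^iH\subset p^iH$ for $0\le i\le3$ and some $\phi$. Let $H$ be a divisible ordinary Hodge $F$-crystal over $A_0$ of level $\le3$. Let $0=U_{-1}\subset U_0\subset U_1\subset\cdots$ be the filtration of $H$ by sub-$F$-crystals such that $U_i\otimes_A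 A_0=\mathrm{Fil}_iH_0$ and $U_i/U_{i-1}\simeq V_i(-i)$ with $V_i$ a unit $F$-crystal (one for which the $F(\phi)$ are isomorphisms) and $(-i)$ the Tate twist (which multiplies $F(\phi)$ by $p^i$). Put $H^i=U_i\cap\mathrm{Fil}^iH$ and assume that $H^0,H^1,H^2,H^3$ have ranks $1,h,h,1$. Let $\langle\,,\rangle:H\times H\to A$ be a perfect alternating bilinear form with $\langle D_jx,y\rangle+\langle x,D_jy\rangle=\frac{\partial}{\partial t_j}\langle x,y\rangle$ and $\langle F(\phi)\phi^*x,F(\phi)\phi^*y\rangle=p^3\phi(\langle x,y\rangle)$ for all $x,y\in H$, all $j$ and all lifts $\phi$, and with $(\mathrm{Fil}^3H)^\perp=\mathrm{Fil}^1H$, $(\mathrm{Fil}^2H)^\perp=\mathrm{Fil}^2H$. Assume that the $A$-linear map from the free module on $\partial/\partial t_1,\dots,\partial/\partial t_h$ to $\mathrm{Hom}_A(H^3,H^2)=\mathrm{Hom}_A(\mathrm{Fil}^3H,\mathrm{Fil}^2H/\mathrm{Fil}^3H)$ given by $\partial/\partial t_j\mapsto D_j$ is an isomorphism. Let $\overline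 H=\overline A\otimes_AH$ be the base change of the $F$-crystal $H$ to $\bar k$, with the induced form, and let $\overline H^i=(\overline A\otimes_A U_i)\cap(\overline A\otimes_A \mathrm{Fil}^iH)$. Let $e_0,\dots,e_{2h+1}$ be an $\overline A$-basis of $\overline H$ and let $$\mathcal T=\begin{pmatrix}1&\tau_{23}^\star&0&0\\0&I_h&0&0\\0&0&I_h&\tau_{23}\\0&0&0&1\end{pmatrix}\begin{pmatrix}1&0&-\tau_{13}^\star&Z\\0&I_h&\tau_{12}&\tau_{13}\\0&0&I_h&0\\0&0&0&1\end{pmatrix}$$ be a matrix with entries in $K^{\mathrm u}[[t_1,\dots,t_h]]$ (where $\star$ is the transpose), such that $e_0\in\overline H^0$, $e_1,\dots,e_h\in\overline H^1$, $e_{h+1},\dots,e_{2h}\in\overline H^2$, $e_{2h+1}\in\overline H^3$, the Gram matrix of the basis is $$\begin{pmatrix}0&0&0&-1\\0&0&I_h&0\\0&-I_h&0&0\\1&0&0&0\end{pmatrix},$$ the matrix of $\nabla$ is $\mathcal T^{-1}d\mathcal T$, and for every lift of Frobenius $\psi$ on $\overline A$ the matrix of $F(\psi)\psi^*$ is $\mathcal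 T^{-1}\cdot\mathrm{diag}(1,pI_h,p^2I_h,p^3)\cdot\psi(\mathcal T)$; here $\psi(\sum_m a_mt^m)=\sum_m\sigma(a_m)\psi(t)^m$, with $p$-adic convergence of every coefficient. Write $\tau_{23}=(\tau_1,\dots,\tau_h)^\star$. **Proposition.** Let $\omega_0$ be a generator of the $A$-module $\mathrm{Fil}^3H=H^3$. Then there is a unit $f\in\overline A^\times$ with $\omega_0=f e_{2h+1}$ in $\overline H$. The matrix $\big(\frac{\partial\tau_i}{\partial t_j}\big)_{1\le i,j\le h}$ has entries in $\overline A$ and is invertible over $\overline A$; denote its inverse by $\big(\frac{\partial t_i}{\partial\tau_j}\big)_{1\le i,j\le h}$. Put $$\check\omega_0=f^{-1}e_0,\qquad \check\omega_i=\sum_{m=1}^hf^{-1}\frac{\partial t_i}{\partial\tau_m}e_m,\qquad \check\omega_{h+j}=\omega_j=fD_j(f^{-1}\omega_0),\qquad \check\omega_{2h+1}=\omega_0\qquad(1\le i,j\le h).$$ These elements, a priori in $\overline H$, lie in $H$, and $\{\check\omega_0,\dots,\check\omega_{2h+1}\}$ is an $A$-basis of $H$ with $$\check\omega_0\in H^0,\qquad\check\omega_1,\dots,\check\omega_h\in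 H^1,\qquad\check\omega_{h+1},\dots,\check\omega_{2h}\in H^2,\qquad\check\omega_{2h+1}\in H^3.$$ The matrix $\mathcal S$ with $(\check\omega_0,\dots,\check\omega_{2h+1})=(e_0,\dots,e_{2h+1})\mathcal S$ is $$\mathcal S=\begin{pmatrix}f^{-1}&0&0&0\\0&f^{-1}\big(\frac{\partial t_j}{\partial\tau_i}\big)&0&0\\0&0&f\big(\frac{\partial\tau_i}{\partial t_j}\big)&0\\0&0&0&f\end{pmatrix}$$ (row index $i$ and column index $j$ in the middle blocks). -/

import Mathlib

open scoped TensorProduct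

noncomputable section

namespace CY3

/-- The ring homomorphism `W(k) → W(k')` induced by `k → k'`, as an algebra structure. -/
instance (priority := 10) wittAlgebra (p : ℕ) [Fact p.Prime] (k k' : Type*) [Field k] [Field k']
    [Algebra k k'] : Algebra (WittVector p k) (WittVector p k') :=
  (WittVector.map (algebraMap k k')).toAlgebra

/-- `W(k)[[t_1, …, t_n]]`. -/
abbrev PS (p : ℕ) [Fact p.Prime] (k : Type*) [Field k] (n : ℕ) : Type _ :=
  MvPowerSeries (Fin n) (WittVector p k)

/-- `K^u[[t_1, …, t_n]]` with `K^u = W(k)[1/p] = Frac W(k)`. -/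
abbrev KPS (p : ℕ) [Fact p.Prime] (k : Type*) [Field k] (n : ℕ) : Type _ :=
  MvPowerSeries (Fin n) (FractionRing (WittVector p k))

section Crystals

variable (p : ℕ) [Fact p.Prime] (k : Type*) [Field k] (n : ℕ)

/-- The inclusion `W(k)[[t]] → K^u[[t]]`. -/
def toKPS : PS p k n →+* KPS p k n :=
  MvPowerSeries.map (algebraMap (WittVector p k) (FractionRing (WittVector p k)))

/-- The partial derivative `∂/∂t_j` on `W(k)[[t]]`. -/
def dA (j : Fin n) (a : PS p k n) : PS p k n :=
  MvPowerSeries.pderiv (WittVector p k) j a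

/-- The partial derivative `∂/∂t_j` on `K^u[[t]]`. -/
def dK (j : Fin n) (a : KPS p k n) : KPS p k n :=
  MvPowerSeries.pderiv (FractionRing (WittVector p k)) j a

/-- The coordinate `t_j`. -/
def tvar (j : Fin n) : PS p k n := MvPowerSeries.X j

/-- A lift of Frobenius on `A = W(k)[[t]]`: a ring endomorphism which restricts to the Witt vector
Frobenius on `W(k)` and reduces to `a ↦ a ^ p` modulo `p`. -/
structure FrobLift where
  toHom : PS p k n →+* PS p k n
  map_const : ∀ w : WittVector p k,
    toHom (MvPowerSeries.C w) = MvPowerSeries.C (WittVector.frobenius w)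
  map_mod_p : ∀ a : PS p k n, ∃ b : PS p k n, toHom a = a ^ p + (p : PS p k n) * b

variable {p k n}

/-- The composite `D_1^{m_1} ∘ ⋯ ∘ D_n^{m_n}`. -/
def iterD {H : Type*} [AddCommGroup H] (D : Fin n → AddMonoid.End H) (m : Fin n →₀ ℕ) :
    AddMonoid.End H :=
  (List.ofFn fun j => D j ^ m j).prod

/-- `γ j m = (p ^ m / m!) * ((φ t_j - ψ t_j) / p) ^ m`; as `A` has no torsion, this equation
determines `γ`. -/
def IsTaylorCoeff (φ ψ : FrobLift p k n) (γ : Fin n → ℕ → PS p k n) : Prop :=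
  ∀ j m, (m.factorial : PS p k n) * γ j m
    = (φ.toHom (tvar p k n j) - ψ.toHom (tvar p k n j)) ^ m

/-- The submodule `p ^ i M` for a submodule `M` of an `A`-module. -/
def pPow {H : Type*} [AddCommGroup H] [Module (PS p k n) H] (i : ℕ)
    (M : Submodule (PS p k n) H) : Submodule (PS p k n) H :=
  Ideal.span {(p : PS p k n) ^ i} • M

variable (p k n) in
/-- An `F`-crystal over `A_0 = k[[t_1, …, t_n]]`, on the `A`-module `H`, `A = W(k)[[t]]`.

The module of (continuous) differentials of `A` over `W(k)` is free on `dt_1, …, dt_n`, so the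
connection is `∇ x = ∑ dt_j ⊗ D_j x`. The `A`-linear map `F(φ) : φ^* H → H` is given by the
corresponding `φ`-semilinear map `F φ = F(φ) φ^* : H → H`. -/
structure FCrystal (H : Type*) [AddCommGroup H] [Module (PS p k n) H] where
  free : Module.Free (PS p k n) H
  finite : Module.Finite (PS p k n) H
  D : Fin n → AddMonoid.End H
  leibniz : ∀ (j : Fin n) (a : PS p k n) (x : H), D j (a • x) = dA p k n j a • x + a • D j x
  integrable : ∀ (i j : Fin n) (x : H), D i (D j x) = D j (D i x)
  /-- `D_j ^ m → 0` for the `p`-adic topology on `End_W H`. -/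
  nilpotent : ∀ (j : Fin n) (N : ℕ), ∃ M : ℕ, ∀ m ≥ M, ∀ x : H,
    (D j ^ m) x ∈ pPow N (⊤ : Submodule (PS p k n) H)
  F : (φ : FrobLift p k n) → H →ₛₗ[φ.toHom] H
  /-- `F(φ)` is horizontal: `∇ ∘ F(φ)φ^* = (φ ⊗ F(φ)φ^*) ∘ ∇`, where
  `φ (dt_j) = d (φ t_j) = ∑ᵢ ∂(φ t_j)/∂t_i dt_i`. -/
  horizontal : ∀ (φ : FrobLift p k n) (i : Fin n) (x : H),
    D i (F φ x) = ∑ j, dA p k n i (φ.toHom (tvar p k n j)) • F φ (D j x)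
  /-- `F(φ) = F(ψ) ∘ χ(φ, ψ)`: the Taylor series
  `F(φ)φ^* x = ∑_m ∏_j (p^{m_j}/m_j!) ((φ t_j - ψ t_j)/p)^{m_j} F(ψ)ψ^* (D^m x)`
  converges `p`-adically (as an unordered sum) to the left-hand side. -/
  taylor : ∀ (φ ψ : FrobLift p k n) (γ : Fin n → ℕ → PS p k n), IsTaylorCoeff φ ψ γ →
    ∀ (x : H) (N : ℕ), ∃ S₀ : Finset (Fin n →₀ ℕ), ∀ S : Finset (Fin n →₀ ℕ), S₀ ⊆ S →
      F φ x - ∑ m ∈ S, (∏ j, γ j (m j)) • F ψ (iterD D m x)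
        ∈ pPow N (⊤ : Submodule (PS p k n) H)
  /-- `F(φ) ⊗ ℚ_p` is surjective; being a map between free modules of the same finite rank, it is
  then an isomorphism. -/
  isogeny : ∀ φ : FrobLift p k n, ∃ N : ℕ, ∀ y : H,
    (p : PS p k n) ^ N • y ∈ Submodule.span (PS p k n) (Set.range (F φ))

variable (p k n) in
/-- The ideal `pA`. -/
abbrev pIdeal : Ideal (PS p k n) := Ideal.span {(p : PS p k n)}

variable (p k n) in
/-- `A_0 = A / pA = k[[t_1, …, t_n]]`. -/
abbrev A₀ : Type _ := PS p k n ⧸ pIdeal p k n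

variable (p k n) in
/-- `H_0 = H ⊗_A A_0 = H / pH`. -/
abbrev Red (H : Type*) [AddCommGroup H] [Module (PS p k n) H] : Type _ :=
  H ⧸ (pIdeal p k n • (⊤ : Submodule (PS p k n) H))

/-- The image in `H_0` of a submodule of `H`, as an `A_0`-submodule. -/
def redImage {H : Type*} [AddCommGroup H] [Module (PS p k n) H] (V : Submodule (PS p k n) H) :
    Submodule (A₀ p k n) (Red p k n H) where
  carrier := {x | ∃ y ∈ V, Submodule.Quotient.mk y = x}
  add_mem' := by
    rintro _ _ ⟨y, hy, rfl⟩ ⟨z, hz, rfl⟩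
    exact ⟨y + z, V.add_mem hy hz, rfl⟩
  zero_mem' := ⟨0, V.zero_mem, rfl⟩
  smul_mem' := by
    rintro c _ ⟨y, hy, rfl⟩
    obtain ⟨a, rfl⟩ := Ideal.Quotient.mk_surjective c
    exact ⟨a • y, V.smul_mem a hy, rfl⟩

/-- The successive steps `V_i / V_{i-1}` of an increasing filtration use `V_{-1} = 0`. -/
def prev {R M : Type*} [Ring R] [AddCommGroup M] [Module R M] (V : ℕ → Submodule R M) :
    ℕ → Submodule R M
  | 0 => ⊥
  | i + 1 => V i

/-- `V ⊗_A A_0 = V₀` for `V ⊆ H`, `V₀ ⊆ H_0`: the natural map `V ⊗_A A_0 → H_0` has image `V₀` and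
is injective, i.e. `V ∩ pH = pV` (recall that `H` has no `p`-torsion). -/
def Lifts {H : Type*} [AddCommGroup H] [Module (PS p k n) H] (V : Submodule (PS p k n) H)
    (V₀ : Submodule (A₀ p k n) (Red p k n H)) : Prop :=
  redImage V = V₀ ∧ ∀ x : H, (p : PS p k n) • x ∈ V → x ∈ V

namespace FCrystal

variable {H : Type*} [AddCommGroup H] [Module (PS p k n) H] (X : FCrystal p k n H)

/-- The image of the `A`-linear map `F(φ) : φ^* H → H`. -/
def imF (φ : FrobLift p k n) : Submodule (PS p k n) H :=
  Submodule.span (PS p k n) (Set.range (X.F φ))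

/-- The conjugate filtration `Fil_i H_0 = {x | ∃ y lifting x, p ^ i y ∈ Im F(φ)}`. -/
def conj (φ : FrobLift p k n) (i : ℕ) : Submodule (A₀ p k n) (Red p k n H) :=
  redImage ((X.imF φ).comap (LinearMap.lsmul (PS p k n) H ((p : PS p k n) ^ i)))

/-- The Hodge filtration `Fil^i H_0 = {x | ∃ y lifting x, F(φ)φ^* y ∈ p ^ i H}`. -/
def hodge (φ : FrobLift p k n) (i : ℕ) : Submodule (A₀ p k n) (Red p k n H) :=
  redImage ((pPow i (⊤ : Submodule (PS p k n) H)).comap (X.F φ))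

/-- `H` is ordinary: the graded module of the conjugate filtration is free over `A_0`, and
`H_0 = Fil_i H_0 ⊕ Fil^{i+1} H_0` for all `i`. -/
def IsOrdinary : Prop :=
  ∀ φ : FrobLift p k n,
    (∀ i, Module.Free (A₀ p k n)
      (X.conj φ i ⧸ (prev (X.conj φ) i).submoduleOf (X.conj φ i))) ∧
    ∀ i, IsCompl (X.conj φ i) (X.hodge φ (i + 1))

/-- `H` is of level `≤ N`. -/
def LevelLE (N : ℕ) : Prop :=
  ∀ φ : FrobLift p k n, X.conj φ N = ⊤ ∧ X.hodge φ (N + 1) = ⊥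

/-- `U` is the filtration `0 = U_{-1} ⊆ U_0 ⊆ U_1 ⊆ ⋯` of `H` by sub-`F`-crystals which lifts the
conjugate filtration and whose `i`-th step `U_i / U_{i-1}` is a Tate twist `V_i(-i)` of a unit
`F`-crystal `V_i`. The last condition says that `U_i / U_{i-1}` is free and that the
`A`-submodule generated by the image of its Frobenius `F(φ)φ^*` is exactly `p ^ i (U_i / U_{i-1})`
(so that `p ^ {-i} F(φ)` is defined on it and is an isomorphism). -/
structure IsUnitFiltration (U : ℕ → Submodule (PS p k n) H) : Prop where
  mono : Monotone U
  free : ∀ i, Module.Free (PS p k n) (U i)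
  stable_D : ∀ i j, ∀ x ∈ U i, X.D j x ∈ U i
  stable_F : ∀ i φ, ∀ x ∈ U i, X.F φ x ∈ U i
  lifts : ∀ i φ, Lifts (U i) (X.conj φ i)
  gr_free : ∀ i, Module.Free (PS p k n) (U i ⧸ (prev U i).submoduleOf (U i))
  gr_unit : ∀ i φ,
    Submodule.span (PS p k n) (X.F φ '' (U i : Set H)) ⊔ prev U i = pPow i (U i) ⊔ prev U i

/-- The `F`-crystal `Xb` on `Ā ⊗_A H`, `Ā = W(k')[[t]]`, is the base change of `X` from `k` to
`k'`: its connection extends the one of `H`, and if `φ'` is a lift of Frobenius on `Ā` which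
restricts to the lift `φ` on `A`, then `F(φ')` is the `Ā`-linear extension of `F(φ)`. (The maps
`F(ψ)` for the other lifts `ψ` are determined by the Taylor formula.) -/
structure IsBaseChange {k' : Type*} [Field k'] [Algebra k k']
    (Xb : FCrystal p k' n (PS p k' n ⊗[PS p k n] H)) : Prop where
  D_eq : ∀ (j : Fin n) (x : H), Xb.D j (1 ⊗ₜ[PS p k n] x) = 1 ⊗ₜ[PS p k n] X.D j x
  F_eq : ∀ (φ : FrobLift p k n) (φ' : FrobLift p k' n),
    (∀ a : PS p k n, φ'.toHom (algebraMap (PS p k n) (PS p k' n) a)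
      = algebraMap (PS p k n) (PS p k' n) (φ.toHom a)) →
    ∀ x : H, Xb.F φ' (1 ⊗ₜ[PS p k n] x) = 1 ⊗ₜ[PS p k n] X.F φ x

end FCrystal

variable (p k n) in
/-- A Hodge `F`-crystal: an `F`-crystal with a filtration by free submodules which lifts the Hodge
filtration of `H_0` and satisfies Griffiths transversality. -/
structure HodgeFCrystal (H : Type*) [AddCommGroup H] [Module (PS p k n) H]
    extends FCrystal p k n H where
  Fil : ℕ → Submodule (PS p k n) H
  Fil_zero : Fil 0 = ⊤
  Fil_anti : Antitone Fil
  Fil_free : ∀ i, Module.Free (PS p k n) (Fil i)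
  Fil_lifts : ∀ i φ, Lifts (Fil i) (toFCrystal.hodge φ i)
  griffiths : ∀ i j, ∀ x ∈ Fil (i + 1), D j x ∈ Fil i

namespace HodgeFCrystal

variable {H : Type*} [AddCommGroup H] [Module (PS p k n) H] (X : HodgeFCrystal p k n H)

/-- `H` is divisible: `F(φ)φ^* Fil^i H ⊆ p ^ i H` for `0 ≤ i ≤ N`, for some lift `φ`. -/
def IsDivisible (N : ℕ) : Prop :=
  ∃ φ : FrobLift p k n, ∀ i ≤ N, ∀ x ∈ X.Fil i,
    X.F φ x ∈ pPow i (⊤ : Submodule (PS p k n) H)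

/-- `H^i = U_i ∩ Fil^i H`. -/
def piece (U : ℕ → Submodule (PS p k n) H) (i : ℕ) : Submodule (PS p k n) H :=
  U i ⊓ X.Fil i

/-- A divisible ordinary Hodge `F`-crystal of level `3`, with unit filtration `U` and Hodge numbers
`1, h, h, 1`, and a non-degenerate (i.e. perfect) alternating form which is compatible with the
connection and with Frobenius and satisfies the Riemann bilinear relations. -/
structure IsOrdinaryCY3 (U : ℕ → Submodule (PS p k n) H) (B : LinearMap.BilinForm (PS p k n) H)
    (h : ℕ) : Prop where
  ordinary : X.IsOrdinary
  level : X.LevelLE 3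
  divisible : X.IsDivisible 3
  filtration : X.IsUnitFiltration U
  rank_zero : Module.finrank (PS p k n) (X.piece U 0) = 1
  rank_one : Module.finrank (PS p k n) (X.piece U 1) = h
  rank_two : Module.finrank (PS p k n) (X.piece U 2) = h
  rank_three : Module.finrank (PS p k n) (X.piece U 3) = 1
  alt : ∀ x, B x x = 0
  perfect : Function.Bijective B
  form_D : ∀ j x y, B (X.D j x) y + B x (X.D j y) = dA p k n j (B x y)
  form_F : ∀ (φ : FrobLift p k n) (x y : H),
    B (X.F φ x) (X.F φ y) = (p : PS p k n) ^ 3 * φ.toHom (B x y)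
  riemann_three : B.orthogonal (X.Fil 3) = X.Fil 1
  riemann_two : B.orthogonal (X.Fil 2) = X.Fil 2

/-- The `A`-linear map `Fil^3 H → Fil^2 H / Fil^3 H` induced by `D_j` (if `H` is a CY3 crystal,
`Fil^3 H = H^3` and `Fil^2 H / Fil^3 H = H^2`). -/
def ks (j : Fin n) :
    X.Fil 3 →ₗ[PS p k n] (X.Fil 2 ⧸ (X.Fil 3).submoduleOf (X.Fil 2)) where
  toFun x := Submodule.Quotient.mk ⟨X.D j x, X.griffiths 2 j x x.2⟩
  map_add' x y := by
    rw [← Submodule.Quotient.mk_add]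
    congr 1
    ext
    simp
  map_smul' a x := by
    rw [RingHom.id_apply, ← Submodule.Quotient.mk_smul, Submodule.Quotient.eq]
    have : dA p k n j a • (x : H) ∈ X.Fil 3 := (X.Fil 3).smul_mem _ x.2
    simpa [Submodule.submoduleOf, X.leibniz] using this

/-- The map `T_{A/W} → Hom(H^3, H^2)`, `∑ a_j ∂/∂t_j ↦ ∑ a_j D_j`, is an isomorphism. -/
def KodairaSpencerIso : Prop :=
  Function.Bijective (fun a : Fin n → PS p k n => ∑ j, a j • X.ks j)

end HodgeFCrystal

end Crystals

/-- The index set `0, 1, …, h, h + 1, …, 2h, 2h + 1`, in blocks of size `1, h, h, 1`. -/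
abbrev Idx (h : ℕ) : Type := (Unit ⊕ Fin h) ⊕ (Fin h ⊕ Unit)

/-- The index `0`. -/
def i0 {h : ℕ} : Idx h := Sum.inl (Sum.inl ())
/-- The index `i`, for `1 ≤ i ≤ h`. -/
def i1 {h : ℕ} (i : Fin h) : Idx h := Sum.inl (Sum.inr i)
/-- The index `h + i`, for `1 ≤ i ≤ h`. -/
def i2 {h : ℕ} (i : Fin h) : Idx h := Sum.inr (Sum.inl i)
/-- The index `2h + 1`. -/
def i3 {h : ℕ} : Idx h := Sum.inr (Sum.inr ())

/-- The number of the block which contains an index. -/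
def deg {h : ℕ} : Idx h → ℕ
  | Sum.inl (Sum.inl _) => 0
  | Sum.inl (Sum.inr _) => 1
  | Sum.inr (Sum.inl _) => 2
  | Sum.inr (Sum.inr _) => 3

open Matrix

/-- The Gram matrix with rows `(0, 0, 0, -1)`, `(0, 0, I, 0)`, `(0, -I, 0, 0)`, `(1, 0, 0, 0)`. -/
def gram (R : Type*) [CommRing R] (h : ℕ) : Matrix (Idx h) (Idx h) R :=
  fromBlocks 0 (fromBlocks 0 (-1) 1 0) (fromBlocks 0 (-1) 1 0) 0

/-- `diag(1, p I, p² I, p³)`. -/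
def Pmat (R : Type*) [CommRing R] (h p : ℕ) : Matrix (Idx h) (Idx h) R :=
  diagonal fun c => (p : R) ^ deg c

/-- The matrix `𝒯`, as the product of the matrix with rows `(1, τ₂₃ᵀ, 0, 0)`, `(0, I, 0, 0)`,
`(0, 0, I, τ₂₃)`, `(0, 0, 0, 1)` and the matrix with rows `(1, 0, -τ₁₃ᵀ, Z)`, `(0, I, τ₁₂, τ₁₃)`,
`(0, 0, I, 0)`, `(0, 0, 0, 1)`. -/
def Tmat {R : Type*} [CommRing R] {h : ℕ} (Z : R) (τ₂₃ τ₁₃ : Fin h → R)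
    (τ₁₂ : Matrix (Fin h) (Fin h) R) : Matrix (Idx h) (Idx h) R :=
  fromBlocks (fromBlocks 1 (replicateRow Unit τ₂₃) 0 1) 0 0
      (fromBlocks 1 (replicateCol Unit τ₂₃) 0 1) *
    fromBlocks 1
      (fromBlocks (-replicateRow Unit τ₁₃) (of fun _ _ => Z) τ₁₂ (replicateCol Unit τ₁₃)) 0 1

/-- The matrix `diag(f⁻¹, f⁻¹ (∂t_j/∂τ_i), f (∂τ_i/∂t_j), f)` (row index `i`, column index `j` in
the middle blocks). Here `J = (∂τ_i/∂t_j)` is an invertible matrix, so that by the chain rule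
`∂t_j/∂τ_i` is the entry of `J⁻¹` in row `j` and column `i`. -/
def Smat {R : Type*} [CommRing R] {h : ℕ} (f : Rˣ) (J : Matrix (Fin h) (Fin h) R) :
    Matrix (Idx h) (Idx h) R :=
  fromBlocks
    (fromBlocks (of fun _ _ => (↑f⁻¹ : R)) 0 0 (of fun i j => (↑f⁻¹ : R) * J⁻¹ j i)) 0 0
    (fromBlocks (of fun i j => (f : R) * J i j) 0 0 (of fun _ _ => (f : R)))

section Frob

variable {p : ℕ} [Fact p.Prime] {k : Type*} [Field k] [CharP k p] [PerfectRing k p] {n : ℕ}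

/-- `τ' = ψ(τ)` for `τ = ∑ a_m t^m` in `K^u[[t]]`: one has `τ' = ∑_m σ(a_m) ψ(t)^m`, where for each
monomial `t^d` the series of coefficients of `t^d` converges in the `p`-adic topology of `K^u`. -/
def IsFrobImage (ψ : FrobLift p k n) (τ τ' : KPS p k n) : Prop :=
  ∀ (d : Fin n →₀ ℕ) (N : ℕ), ∃ S₀ : Finset (Fin n →₀ ℕ), ∀ S : Finset (Fin n →₀ ℕ), S₀ ⊆ S →
    ∃ w : WittVector p k,
      MvPowerSeries.coeff d τ'
        - ∑ m ∈ S, WittVector.FractionRing.frobeniusRingHom p k (MvPowerSeries.coeff m τ)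
          * MvPowerSeries.coeff d (toKPS p k n (∏ j, ψ.toHom (tvar p k n j) ^ m j))
      = algebraMap (WittVector p k) (FractionRing (WittVector p k)) ((p : WittVector p k) ^ N * w)

end Frob

section Adapted

variable {p : ℕ} [Fact p.Prime] {k k' : Type*} [Field k] [Field k'] [Algebra k k'] {h : ℕ}
  {H : Type*} [AddCommGroup H] [Module (PS p k h) H]

/-- `H̄^i = Ū_i ∩ Fil^i H̄` in `H̄ = Ā ⊗_A H`, where `Ū_i` and `Fil^i H̄` are the base changes of
`U_i` and `Fil^i H`. -/
def HodgeFCrystal.pieceBar {n : ℕ} {H : Type*} [AddCommGroup H] [Module (PS p k n) H] (k' : Type*)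
    [Field k'] [Algebra k k'] (X : HodgeFCrystal p k n H)
    (U : ℕ → Submodule (PS p k n) H) (i : ℕ) :
    Submodule (PS p k' n) (PS p k' n ⊗[PS p k n] H) :=
  (U i).baseChange (PS p k' n) ⊓ (X.Fil i).baseChange (PS p k' n)

/-- `(e_0, …, e_{2h+1})` and `𝒯` are a basis of `H̄` and a matrix of the kind used to describe the
structure of ordinary CY3 crystals: the basis is adapted to `H̄ = H̄^0 ⊕ H̄^1 ⊕ H̄^2 ⊕ H̄^3`,
has the standard Gram matrix, the matrix of the connection is `𝒯⁻¹ d𝒯`, and the matrix of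
`F(ψ)ψ^*` is `𝒯⁻¹ P ψ(𝒯)` for every lift of Frobenius `ψ`. -/
structure IsStructureBasis [CharP k' p] [PerfectRing k' p] (X : HodgeFCrystal p k h H)
    (U : ℕ → Submodule (PS p k h) H) (B : LinearMap.BilinForm (PS p k h) H)
    (Xb : FCrystal p k' h (PS p k' h ⊗[PS p k h] H))
    (e : Module.Basis (Idx h) (PS p k' h) (PS p k' h ⊗[PS p k h] H))
    (T : Matrix (Idx h) (Idx h) (KPS p k' h)) : Prop where
  mem : ∀ c, e c ∈ X.pieceBar k' U (deg c)
  gram_eq : (of fun c d => LinearMap.BilinForm.baseChange (PS p k' h) B (e c) (e d))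
    = gram (PS p k' h) h
  connection : ∀ j : Fin h,
    (e.toMatrix fun c => Xb.D j (e c)).map (toKPS p k' h) = T⁻¹ * T.map (dK p k' h j)
  frobenius : ∀ ψ : FrobLift p k' h, ∃ ψT : Matrix (Idx h) (Idx h) (KPS p k' h),
    (∀ r c, IsFrobImage ψ (T r c) (ψT r c)) ∧
    (e.toMatrix fun c => Xb.F ψ (e c)).map (toKPS p k' h) = T⁻¹ * Pmat (KPS p k' h) h p * ψT

end Adapted

end CY3

end

/-! The summands `U i ⊓ X.Fil i` are cut out by projections `ρ i` defined over `A`, and the base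
change of `ρ i` keeps the `i`-th block of `e` and kills the others. Hence whatever is the `i`-th
component over `Ā` of an element of `H` lies in `H` itself; this is how each new element descends.

Both `ω₀` and `e i3` generate the base change of `Fil³`, so they differ by a unit `f`. The
derivative `D_j (e i3)` has no components in blocks 0 and 1 (Griffiths transversality and isotropy
of `Fil²`) and none in block 3 (shape of `𝒯`); its block 2 is the Jacobian column `∂τ/∂t_j`. So `f
D_j(f⁻¹ ω₀)` is the block 2 component of `D_j ω₀`. The Kodaira–Spencer isomorphism says that these
elements form a basis of `H²`, which also makes `J` invertible (`isUnit_det_jacobian`).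

For blocks 0 and 1, perfectness of the form over `A` provides elements of `H` dual to `-ω₀` and to
the `ω j`; the Gram matrix identifies their projections to `H⁰` and `H¹` (`tmul_piece_zero`,
`tmul_piece_one`). The resulting family is a basis since `det 𝒮` is a unit and `A → Ā` is local
(`exists_basis_of_baseChange`). -/

namespace CY3

open Matrix

/-! ### Projections, bases and dual families under base change. -/

section LinearAlgebra

variable {R R' M : Type*} [CommRing R] [CommRing R'] [Algebra R R'] [AddCommGroup M] [Module R M]

/-- Linear maps which agree on a submodule agree, after base change, on its base change. -/
theorem baseChange_eqOn {f g : M →ₗ[R] M} {V : Submodule R M} (hfg : ∀ x ∈ V, f x = g x)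
    {z : R' ⊗[R] M} (hz : z ∈ V.baseChange R') : f.baseChange R' z = g.baseChange R' z := by
  rw [Submodule.baseChange_eq_span] at hz
  induction hz using Submodule.span_induction with
  | mem z hz =>
    obtain ⟨x, hx, rfl⟩ := hz
    simp [hfg x hx]
  | zero => simp
  | add x y _ _ hx hy => simp [hx, hy]
  | smul a x _ hx => simp [hx]

/-- The projection onto `U` along a complement `V`. -/
theorem exists_projection {U V : Submodule R M} (hUV : IsCompl U V) :
    ∃ π : M →ₗ[R] M, (∀ x, π x ∈ U) ∧ (∀ x, x - π x ∈ V) ∧ (∀ x ∈ U, π x = x) ∧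
      ∀ x ∈ V, π x = 0 := by
  refine ⟨U.projection V hUV, fun x => Submodule.projection_apply_mem hUV x, fun x => ?_,
    fun x hx => Submodule.projection_apply_left hUV ⟨x, hx⟩,
    fun x hx => (Submodule.projection_apply_eq_zero_iff hUV).2 hx⟩
  rw [← Submodule.projection_apply_eq_zero_iff hUV, map_sub,
    Submodule.projection_apply_left hUV ⟨_, Submodule.projection_apply_mem hUV x⟩, sub_self]

/-- Two opposite filtrations `U` and `V` split a module into the pieces `U i ⊓ V i`. -/
theorem exists_piece_projection {U V : ℕ → Submodule R M} (hU : Monotone U) (hV : Antitone V)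
    (hV0 : V 0 = ⊤) (hc : ∀ i, IsCompl (U i) (V (i + 1))) (i : ℕ) :
    ∃ ρ : M →ₗ[R] M, (∀ x, ρ x ∈ U i ⊓ V i) ∧ (∀ x ∈ V i, x - ρ x ∈ V (i + 1)) ∧
      (∀ x ∈ V (i + 1), ρ x = 0) ∧
      (∀ (j : ℕ) (z : R' ⊗[R] M), z ∈ (U j).baseChange R' ⊓ (V j).baseChange R' →
        ρ.baseChange R' z = if j = i then z else 0) := by
  have fix : ∀ {f : M →ₗ[R] M} {W : Submodule R M}, (∀ x ∈ W, f x = x) →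
      ∀ {z : R' ⊗[R] M}, z ∈ W.baseChange R' → f.baseChange R' z = z := by
    intro f W hf z hz
    simpa using baseChange_eqOn (g := LinearMap.id) hf hz
  have kill : ∀ {f : M →ₗ[R] M} {W : Submodule R M}, (∀ x ∈ W, f x = 0) →
      ∀ {z : R' ⊗[R] M}, z ∈ W.baseChange R' → f.baseChange R' z = 0 := by
    intro f W hf z hz
    simpa using baseChange_eqOn (g := 0) hf hz
  obtain ⟨π, hπU, hπV, hπ1, hπ0⟩ := exists_projection (hc i)
  rcases i with _ | i
  · refine ⟨π, fun x => ⟨hπU x, by simp [hV0]⟩, fun x _ => hπV x, hπ0, ?_⟩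
    rintro j z ⟨hz, hz'⟩
    split_ifs with hj
    · subst hj
      exact fix hπ1 hz
    · exact kill hπ0 (Submodule.baseChange_mono R' (hV (by omega)) hz')
  -- The projection onto the piece `i + 1` is the difference of those onto `U (i + 1)` and `U i`:
  -- both fix the lower pieces and both kill the higher ones.
  · obtain ⟨π', hU', hV', h1', h0'⟩ := exists_projection (hc i)
    refine ⟨π - π', fun x => ⟨?_, ?_⟩, fun x hx => ?_, fun x hx => ?_, ?_⟩
    · exact sub_mem (hπU x) (hU (Nat.le_succ i) (hU' x))
    · have := sub_mem (hV' x) (hV (Nat.le_succ _) (hπV x))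
      simpa using this
    · simpa [h0' x hx] using hπV x
    · simp [hπ0 x hx, h0' x (hV (Nat.le_succ _) hx)]
    · rintro j z ⟨hz, hz'⟩
      rw [LinearMap.baseChange_sub, LinearMap.sub_apply]
      split_ifs with hj
      · subst hj
        rw [fix hπ1 hz, kill h0' hz', sub_zero]
      · rcases lt_or_gt_of_ne hj with hj | hj
        · rw [fix hπ1 (Submodule.baseChange_mono R' (hU hj.le) hz),
            fix h1' (Submodule.baseChange_mono R' (hU (Nat.le_of_lt_succ hj)) hz), sub_self]
        · rw [kill hπ0 (Submodule.baseChange_mono R' (hV hj) hz'),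
            kill h0' (Submodule.baseChange_mono R' (hV hj.le) hz'), sub_self]

/-- A family in a free module is a basis if it becomes one over a local extension. -/
theorem exists_basis_of_baseChange [Nontrivial R'] [IsLocalHom (algebraMap R R')]
    [Module.Free R M] [Module.Finite R M] {ι : Type*} [Fintype ι] [DecidableEq ι]
    (e : Module.Basis ι R' (R' ⊗[R] M)) (b : ι → M)
    (hb : IsUnit (e.toMatrix fun c => 1 ⊗ₜ[R] b c).det) :
    ∃ b' : Module.Basis ι R M, ⇑b' = b := by
  let v₀ := Module.Free.chooseBasis R M
  -- Ranks survive base change to a nontrivial ring, so a basis of `M` can be indexed by `ι`.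
  let v : Module.Basis ι R M := v₀.reindex ((v₀.baseChange R').indexEquiv e)
  have hdet : algebraMap R R' (v.det b) = (v.baseChange R').det fun c => 1 ⊗ₜ[R] b c := by
    rw [Module.Basis.det_apply, Module.Basis.det_apply, RingHom.map_det]
    congr 1
    ext i j
    simp [Module.Basis.toMatrix_apply, Algebra.algebraMap_eq_smul_one]
  have hunit : IsUnit (v.det b) := by
    refine isUnit_of_map_unit (algebraMap R R') _ ?_
    rw [hdet, Module.Basis.det_apply, ← Module.Basis.toMatrix_mul_toMatrix _ e, det_mul,
      ← Module.Basis.det_apply]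
    exact ((v.baseChange R').isUnit_det e).mul hb
  obtain ⟨hli, hsp⟩ := v.is_basis_iff_det.2 hunit
  exact ⟨Module.Basis.mk hli hsp.ge, by simp⟩

/-- The coordinates along an independent family which spans the range of a projection. -/
theorem exists_dual_family {ι : Type*} [DecidableEq ι] {v : ι → M} (hv : LinearIndependent R v)
    (ρ : M →ₗ[R] M) (hρ : ∀ x, ρ x ∈ Submodule.span R (Set.range v)) (hρv : ∀ i, ρ (v i) = v i) :
    ∃ ℓ : ι → Module.Dual R M, ∀ i j, ℓ i (v j) = if i = j then 1 else 0 := by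
  refine ⟨fun i => (Module.Basis.span hv).coord i ∘ₗ ρ.codRestrict _ hρ, fun i j => ?_⟩
  have hj : ρ.codRestrict _ hρ (v j) = Module.Basis.span hv j :=
    Subtype.ext (by simp [hρv, Module.Basis.span_apply])
  rw [LinearMap.comp_apply, hj, Module.Basis.coord_apply, Module.Basis.repr_self,
    Finsupp.single_apply]
  simp only [eq_comm]

end LinearAlgebra

/-! ### Coordinates read off from the Gram matrix. -/

section Gram

variable {R M : Type*} [CommRing R] [AddCommGroup M] [Module R M] {h : ℕ}
  {β : LinearMap.BilinForm R M} {e : Module.Basis (Idx h) R M}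

theorem bilin_apply_basis (hβ : (of fun c d => β (e c) (e d)) = gram R h) (z : M) (d : Idx h) :
    β z (e d) = ∑ c, e.repr z c * gram R h c d := by
  conv_lhs => rw [← e.sum_repr z]
  simp only [← hβ, map_sum, map_smul, LinearMap.sum_apply, LinearMap.smul_apply, smul_eq_mul,
    of_apply]

theorem bilin_apply_i3 (hβ : (of fun c d => β (e c) (e d)) = gram R h) (z : M) :
    β z (e i3) = -e.repr z i0 := by
  simp [bilin_apply_basis hβ, gram, Fintype.sum_sum_type, i0, i3]

theorem bilin_apply_i2 (hβ : (of fun c d => β (e c) (e d)) = gram R h) (z : M) (m : Fin h) :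
    β z (e (i2 m)) = e.repr z (i1 m) := by
  simp [bilin_apply_basis hβ, gram, Fintype.sum_sum_type, i1, i2, one_apply]

end Gram

/-! ### The matrices `𝒮` and `𝒯`. -/

section Matrices

variable {R : Type*} [CommRing R] {h : ℕ}

theorem isUnit_det_Smat (f : Rˣ) {J : Matrix (Fin h) (Fin h) R} (hJ : IsUnit J.det) :
    IsUnit (Smat f J).det := by
  have h1 : (of fun i j => (↑f⁻¹ : R) * J⁻¹ j i) = (↑f⁻¹ : R) • J⁻¹ᵀ := by
    ext; simp
  have h2 : (of fun i j => (f : R) * J i j) = (f : R) • J := by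
    ext; simp
  rw [Smat, det_fromBlocks_zero₂₁, det_fromBlocks_zero₂₁, det_fromBlocks_zero₂₁, h1, h2, det_smul,
    det_smul, det_transpose]
  simp [hJ, (f⁻¹).isUnit.pow h, f.isUnit.pow h, -Units.inv_eq_val_inv]

theorem det_Tmat (Z : R) (τ₂₃ τ₁₃ : Fin h → R) (τ₁₂ : Matrix (Fin h) (Fin h) R) :
    (Tmat Z τ₂₃ τ₁₃ τ₁₂).det = 1 := by
  simp [Tmat, det_mul, det_fromBlocks_zero₂₁]

/-- In the lower half only `τ₂₃` occurs, so these rows of `𝒯 Γ = d𝒯` suffice to find the block 2 and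
block 3 parts of `∇ (e i3)`. -/
theorem Tmat_eq (Z : R) (τ₂₃ τ₁₃ : Fin h → R) (τ₁₂ : Matrix (Fin h) (Fin h) R) :
    ∃ N₁ N₂, Tmat Z τ₂₃ τ₁₃ τ₁₂
      = fromBlocks N₁ N₂ 0 (fromBlocks 1 (replicateCol Unit τ₂₃) 0 1) := by
  rw [Tmat, fromBlocks_multiply]
  simp

end Matrices

/-! ### Units and `p`-adic separatedness in `W[[t]]`. -/

section PowerSeries

variable {p : ℕ} [Fact p.Prime] {k : Type*} [Field k] {n : ℕ}

theorem dK_one (j : Fin n) : dK p k n j 1 = 0 := MvPowerSeries.pderiv_one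

theorem toKPS_injective [CharP k p] : Function.Injective (toKPS p k n) := by
  intro a b hab
  ext d : 1
  apply IsFractionRing.injective (WittVector p k) (FractionRing (WittVector p k))
  simpa [toKPS] using congr(MvPowerSeries.coeff d $hab)

/-- A Witt vector over a field of characteristic `p` is a unit once its zeroth component is nonzero,
and a zero there would persist in the image. -/
theorem isLocalHom_wittMap {k' : Type*} [Field k'] [CharP k p] (f : k →+* k') :
    IsLocalHom (WittVector.map (p := p) f) := by
  refine ⟨fun a ha => WittVector.isUnit_of_coeff_zero_ne_zero a fun h0 => ?_⟩
  have := ha.map (WittVector.constantCoeff (p := p) (R := k'))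
  simp [h0] at this

variable [CharP k p]

/-- The constant term of `p a + 1` has residue 1 in `k`, so it is a unit of `W`. -/
theorem p_mem_jacobson_bot :
    pIdeal p k n ≤ Ideal.jacobson (⊥ : Ideal (PS p k n)) := by
  rw [Ideal.span_singleton_le_iff_mem, Ideal.mem_jacobson_bot]
  intro a
  rw [MvPowerSeries.isUnit_iff_constantCoeff]
  refine WittVector.isUnit_of_coeff_zero_ne_zero _ ?_
  have h1 : WittVector.constantCoeff (p := p) (R := k)
      (MvPowerSeries.constantCoeff ((p : PS p k n) * a + 1)) = 1 := by
    simp only [map_add, map_mul, map_natCast, CharP.cast_eq_zero, zero_mul, map_one, zero_add]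
  exact h1.trans_ne one_ne_zero

/-- Every power series coefficient of every coordinate lies in all `p ^ N W`, and `W` is
`p`-adically separated. -/
theorem eq_zero_of_forall_p_pow_smul [PerfectRing k p] {H : Type*} [AddCommGroup H]
    [Module (PS p k n) H] [Module.Free (PS p k n) H] {x : H}
    (hx : ∀ N : ℕ, ∃ y, x = (p : PS p k n) ^ N • y) : x = 0 := by
  let v := Module.Free.chooseBasis (PS p k n) H
  refine v.ext_elem fun i => ?_
  ext d : 1
  rw [map_zero, Finsupp.zero_apply, map_zero]
  refine IsHausdorff.haus (I := Ideal.span {(p : WittVector p k)}) inferInstance _ fun N => ?_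
  obtain ⟨y, rfl⟩ := hx N
  rw [SModEq.zero, smul_eq_mul, Ideal.mul_top, Ideal.span_singleton_pow, Ideal.mem_span_singleton]
  refine ⟨MvPowerSeries.coeff d (v.repr y i), ?_⟩
  have : (p : PS p k n) ^ N = MvPowerSeries.C ((p : WittVector p k) ^ N) := by simp
  simp only [map_smul, Finsupp.smul_apply, smul_eq_mul, this, MvPowerSeries.coeff_C_mul]

theorem isLocalHom_algebraMap {kb : Type*} [Field kb] [Algebra k kb] :
    IsLocalHom (algebraMap (PS p k n) (PS p kb n)) := by
  have := isLocalHom_wittMap (p := p) (algebraMap k kb)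
  exact MvPowerSeries.map.isLocalHom (σ := Fin n) (WittVector.map (p := p) (algebraMap k kb))

end PowerSeries

/-! ### Lifting the ordinary splitting from `H_0` to `H`. -/

section Splitting

variable {p : ℕ} [Fact p.Prime] {k : Type*} [Field k] [CharP k p] {n : ℕ}
  {H : Type*} [AddCommGroup H] [Module (PS p k n) H]

/-- Nakayama's lemma, with `p` in the Jacobson radical. -/
theorem eq_top_of_redImage [Module.Finite (PS p k n) H] {V : Submodule (PS p k n) H}
    (hV : redImage V = ⊤) : V = ⊤ := by
  refine top_le_iff.1 (Submodule.le_of_le_smul_of_le_jacobson_bot (I := pIdeal p k n)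
    Module.Finite.fg_top p_mem_jacobson_bot fun x _ => ?_)
  obtain ⟨y, hy, hyx⟩ : (Submodule.Quotient.mk x : Red p k n H) ∈ redImage V := hV ▸ trivial
  rw [Submodule.Quotient.eq] at hyx
  rw [← sub_sub_cancel y x]
  exact sub_mem (Submodule.mem_sup_left hy) (Submodule.mem_sup_right hyx)

/-- An element of `V ∩ W` reduces to 0, hence is `p y`, and saturation puts `y` back in `V ∩ W`;
iterating, it is infinitely `p`-divisible, so zero. The sum is everything by Nakayama. -/
theorem isCompl_of_lifts [PerfectRing k p] [Module.Finite (PS p k n) H]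
    [Module.Free (PS p k n) H] {V W : Submodule (PS p k n) H}
    {V₀ W₀ : Submodule (A₀ p k n) (Red p k n H)} (hV : Lifts V V₀) (hW : Lifts W W₀)
    (hc : IsCompl V₀ W₀) : IsCompl V W := by
  refine ⟨Submodule.disjoint_def.2 fun x hxV hxW => ?_, codisjoint_iff.2 ?_⟩
  · have div : ∀ x ∈ V, x ∈ W → ∃ y, (y ∈ V ∧ y ∈ W) ∧ x = (p : PS p k n) • y := by
      intro x hxV hxW
      have h0 : (Submodule.Quotient.mk x : Red p k n H) = 0 :=
        Submodule.disjoint_def.1 hc.disjoint _ (hV.1 ▸ ⟨x, hxV, rfl⟩) (hW.1 ▸ ⟨x, hxW, rfl⟩)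
      rw [Submodule.Quotient.mk_eq_zero, Submodule.ideal_span_singleton_smul] at h0
      obtain ⟨y, -, rfl⟩ := h0
      exact ⟨y, ⟨hV.2 y hxV, hW.2 y hxW⟩, rfl⟩
    have divN : ∀ N : ℕ, ∃ y, (y ∈ V ∧ y ∈ W) ∧ x = (p : PS p k n) ^ N • y := by
      intro N
      induction N with
      | zero => exact ⟨x, ⟨hxV, hxW⟩, by simp⟩
      | succ N ih =>
        obtain ⟨y, ⟨hyV, hyW⟩, rfl⟩ := ih
        obtain ⟨z, hz, rfl⟩ := div y hyV hyW
        exact ⟨z, hz, by rw [smul_smul, pow_succ]⟩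
    exact eq_zero_of_forall_p_pow_smul fun N => (divN N).imp fun y hy => hy.2
  · refine eq_top_of_redImage (top_le_iff.1 ?_)
    rw [← codisjoint_iff.1 hc.codisjoint, ← hV.1, ← hW.1, sup_le_iff]
    constructor
    · rintro _ ⟨y, hy, rfl⟩
      exact ⟨y, Submodule.mem_sup_left hy, rfl⟩
    · rintro _ ⟨y, hy, rfl⟩
      exact ⟨y, Submodule.mem_sup_right hy, rfl⟩

variable {X : HodgeFCrystal p k n H} {U : ℕ → Submodule (PS p k n) H}
  {B : LinearMap.BilinForm (PS p k n) H} {h : ℕ}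

theorem HodgeFCrystal.IsOrdinaryCY3.isCompl [PerfectRing k p] (hX : X.IsOrdinaryCY3 U B h)
    (i : ℕ) : IsCompl (U i) (X.Fil (i + 1)) := by
  -- Divisibility serves here to supply some lift of Frobenius.
  obtain ⟨φ, -⟩ := hX.divisible
  have := X.free
  have := X.finite
  exact isCompl_of_lifts (hX.filtration.lifts i φ) (X.Fil_lifts (i + 1) φ)
    ((hX.ordinary φ).2 i)

theorem HodgeFCrystal.IsOrdinaryCY3.U_three (hX : X.IsOrdinaryCY3 U B h) : U 3 = ⊤ := by
  obtain ⟨φ, -⟩ := hX.divisible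
  have := X.finite
  exact eq_top_of_redImage ((hX.filtration.lifts 3 φ).1.trans (hX.level φ).1)

end Splitting

/-! ### The basis `e`, the Jacobian of `τ₂₃` and Kodaira–Spencer. -/

section Structure

variable {p : ℕ} [Fact p.Prime] {k : Type*} [Field k]
  {kb : Type*} [Field kb] [CharP kb p] [PerfectRing kb p] [Algebra k kb]
  {h : ℕ} {H : Type*} [AddCommGroup H] [Module (PS p k h) H]
  {X : HodgeFCrystal p k h H} {U : ℕ → Submodule (PS p k h) H}
  {B : LinearMap.BilinForm (PS p k h) H}
  {Xb : FCrystal p kb h (PS p kb h ⊗[PS p k h] H)}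
  {e : Module.Basis (Idx h) (PS p kb h) (PS p kb h ⊗[PS p k h] H)}
  {T : Matrix (Idx h) (Idx h) (KPS p kb h)}

/-- The isotropy of `Fil² H̄` shows that it is contained in the span of `e_{h+1}, …, e_{2h+1}`. -/
theorem IsStructureBasis.repr_eq_zero (he : IsStructureBasis X U B Xb e T)
    (hX : X.IsOrdinaryCY3 U B h) {z : PS p kb h ⊗[PS p k h] H}
    (hz : z ∈ (X.Fil 2).baseChange (PS p kb h)) :
    e.repr z i0 = 0 ∧ ∀ m, e.repr z (i1 m) = 0 := by
  have isotropic : ∀ x ∈ X.Fil 2, ∀ y ∈ X.Fil 2, B x y = 0 := by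
    intro x hx y hy
    rw [← hX.riemann_two] at hy
    exact hy x hx
  have isotropic' : ∀ y ∈ (X.Fil 2).baseChange (PS p kb h),
      LinearMap.BilinForm.baseChange (PS p kb h) B z y = 0 := by
    intro y hy
    rw [Submodule.baseChange_eq_span] at hz hy
    induction hz, hy using Submodule.span_induction₂ with
    | mem_mem x y hx hy =>
      obtain ⟨x, hx, rfl⟩ := hx
      obtain ⟨y, hy, rfl⟩ := hy
      simp [isotropic x hx y hy]
    | zero_left => simp
    | zero_right => simp
    | add_left x y z _ _ _ hx hy => simp [hx, hy]
    | add_right x y z _ _ _ hx hy => simp [hx, hy]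
    | smul_left r x y _ _ hx => simp [hx]
    | smul_right r x y _ _ hx => simp [hx]
  have mem3 : e i3 ∈ (X.Fil 2).baseChange (PS p kb h) :=
    Submodule.baseChange_mono _ (X.Fil_anti (by decide : 2 ≤ 3)) (he.mem i3).2
  -- Up to sign these coordinates are the pairings with `e i3` and `e (i2 m)`, which lie in `Fil²`.
  refine ⟨?_, fun m => ?_⟩
  · rw [← neg_eq_zero, ← bilin_apply_i3 he.gram_eq]
    exact isotropic' _ mem3
  · rw [← bilin_apply_i2 he.gram_eq]
    exact isotropic' _ (he.mem (i2 m)).2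

/-- `ω₀` and `e_{2h+1}` generate the same submodule. -/
theorem IsStructureBasis.exists_unit (he : IsStructureBasis X U B Xb e T) {ω₀ : H}
    (hω₀ : Submodule.span (PS p k h) {ω₀} = X.Fil 3) :
    ∃ f : (PS p kb h)ˣ, 1 ⊗ₜ[PS p k h] ω₀ = (f : PS p kb h) • e i3 := by
  have h3 : e i3 ∈ (X.Fil 3).baseChange (PS p kb h) := (he.mem i3).2
  rw [← hω₀, Submodule.baseChange_span, Set.image_singleton, Submodule.mem_span_singleton] at h3
  obtain ⟨g, hg⟩ := h3
  -- The last coordinate of `g ω₀ = e i3` shows that `g` is a unit; `f` is its inverse.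
  have h1 : g * e.repr (1 ⊗ₜ[PS p k h] ω₀) i3 = 1 := by
    simpa using congr(e.repr $hg i3)
  refine ⟨(Units.mkOfMulEqOne _ _ h1)⁻¹, ?_⟩
  rw [← hg, smul_smul]
  change _ = ((Units.mkOfMulEqOne _ _ h1)⁻¹ * Units.mkOfMulEqOne _ _ h1 : (PS p kb h)ˣ).val • _
  simp

/-- The lower right part of the connection matrix. -/
theorem IsStructureBasis.repr_D {Z : KPS p kb h} {τ₂₃ τ₁₃ : Fin h → KPS p kb h}
    {τ₁₂ : Matrix (Fin h) (Fin h) (KPS p kb h)}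
    (he : IsStructureBasis X U B Xb e (Tmat Z τ₂₃ τ₁₃ τ₁₂)) (j : Fin h) :
    e.repr (Xb.D j (e i3)) i3 = 0 ∧
      ∀ i, toKPS p kb h (e.repr (Xb.D j (e i3)) (i2 i)) = dK p kb h j (τ₂₃ i) := by
  have key : Tmat Z τ₂₃ τ₁₃ τ₁₂ * (e.toMatrix fun c => Xb.D j (e c)).map (toKPS p kb h)
      = (Tmat Z τ₂₃ τ₁₃ τ₁₂).map (dK p kb h j) := by
    rw [he.connection j, mul_nonsing_inv_cancel_left]
    simp [det_Tmat]
  obtain ⟨N₁, N₂, hT⟩ := Tmat_eq Z τ₂₃ τ₁₃ τ₁₂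
  rw [hT] at key
  have h3 : toKPS p kb h (e.repr (Xb.D j (e i3)) i3) = 0 := by
    have := congr($key i3 i3)
    simpa [mul_apply, Fintype.sum_sum_type, i3, i2, Module.Basis.toMatrix_apply, dK_one] using this
  refine ⟨toKPS_injective (by rw [h3, map_zero]), fun i => ?_⟩
  -- This entry reads `Γ₂₃ + τ₂₃ Γ₃₃ = dτ₂₃`, and `Γ₃₃` has just been shown to vanish.
  have := congr($key (i2 i) i3)
  unfold i3 at h3
  simpa [mul_apply, Fintype.sum_sum_type, i3, i2, Module.Basis.toMatrix_apply, one_apply, ite_mul, h3]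
    using this

/-- The connection on the generator `e_{2h+1}` is given by the derivatives of `τ₂₃`. -/
theorem IsStructureBasis.exists_jacobian {Z : KPS p kb h} {τ₂₃ τ₁₃ : Fin h → KPS p kb h}
    {τ₁₂ : Matrix (Fin h) (Fin h) (KPS p kb h)}
    (he : IsStructureBasis X U B Xb e (Tmat Z τ₂₃ τ₁₃ τ₁₂)) (hX : X.IsOrdinaryCY3 U B h)
    (hXb : X.toFCrystal.IsBaseChange Xb) {ω₀ : H} (hω₀ : ω₀ ∈ X.Fil 3) {f : (PS p kb h)ˣ}
    (hf : 1 ⊗ₜ[PS p k h] ω₀ = (f : PS p kb h) • e i3) :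
    ∃ J : Matrix (Fin h) (Fin h) (PS p kb h),
      (∀ i j, toKPS p kb h (J i j) = dK p kb h j (τ₂₃ i)) ∧
      ∀ j, Xb.D j (e i3) = ∑ m, J m j • e (i2 m) := by
  refine ⟨of fun i j => e.repr (Xb.D j (e i3)) (i2 i), fun i j => (he.repr_D j).2 i, fun j => ?_⟩
  have he3 : e i3 = (↑f⁻¹ : PS p kb h) • (1 ⊗ₜ[PS p k h] ω₀) := by
    rw [hf, smul_smul, Units.inv_mul, one_smul]
  have hmem : Xb.D j (e i3) ∈ (X.Fil 2).baseChange (PS p kb h) := by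
    rw [he3, Xb.leibniz, hXb.D_eq]
    exact add_mem
      (Submodule.smul_mem _ _ (Submodule.tmul_mem_baseChange_of_mem _ (X.Fil_anti (by omega) hω₀)))
      (Submodule.smul_mem _ _ (Submodule.tmul_mem_baseChange_of_mem _ (X.griffiths 2 j _ hω₀)))
  obtain ⟨h0, h1⟩ := he.repr_eq_zero hX hmem
  have h3 := (he.repr_D j).1
  conv_lhs => rw [← e.sum_repr (Xb.D j (e i3))]
  unfold i0 i3 at h0
  unfold i1 i3 at h1
  unfold i3 at h3
  simp [Fintype.sum_sum_type, i3, i2, h0, h1, h3, -Module.Basis.sum_repr]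

theorem HodgeFCrystal.sum_ks_apply_eq_mk_iff {a : Fin h → PS p k h} {x : X.Fil 3} {y : X.Fil 2} :
    (∑ j, a j • X.ks j) x = Submodule.Quotient.mk y ↔
      (y : H) - ∑ j, a j • X.D j x ∈ X.Fil 3 := by
  have hx : (∑ j, a j • X.ks j) x = Submodule.Quotient.mk
      (∑ j, a j • (⟨X.D j x, X.griffiths 2 j _ x.2⟩ : X.Fil 2)) := by
    rw [LinearMap.sum_apply, ← Submodule.mkQ_apply, map_sum]
    rfl
  rw [hx, eq_comm, Submodule.Quotient.eq]
  simp [Submodule.submoduleOf]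

/-- The derivatives of a generator of `Fil³ H` generate `Fil² H` modulo `Fil³ H`. -/
theorem HodgeFCrystal.KodairaSpencerIso.exists_sum [CharP k p] (hKS : X.KodairaSpencerIso)
    {ω₀ : H} (hω₀ : Submodule.span (PS p k h) {ω₀} = X.Fil 3) (h0 : ω₀ ≠ 0) {y : H}
    (hy : y ∈ X.Fil 2) : ∃ a : Fin h → PS p k h, y - ∑ j, a j • X.D j ω₀ ∈ X.Fil 3 := by
  have := X.free
  have : IsDomain (PS p k h) := NoZeroDivisors.to_isDomain _
  let ω : X.Fil 3 := ⟨ω₀, hω₀ ▸ Submodule.mem_span_singleton_self ω₀⟩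
  -- `Fil³` is free on `ω₀`, so some map sends `ω₀` to the class of `y`; surjectivity of
  -- Kodaira–Spencer writes it as a combination of the `D_j`.
  let coord : X.Fil 3 →ₗ[PS p k h] PS p k h :=
    (LinearEquiv.coord (PS p k h) H ω₀ h0).toLinearMap ∘ₗ
      (LinearEquiv.ofEq _ _ hω₀.symm).toLinearMap
  have hcoord : coord ω = 1 := LinearEquiv.coord_self (PS p k h) H ω₀ h0
  obtain ⟨a, ha⟩ := hKS.2 (LinearMap.toSpanSingleton (PS p k h) _
    ((X.Fil 3).submoduleOf (X.Fil 2) |>.mkQ ⟨y, hy⟩) ∘ₗ coord)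
  refine ⟨a, (X.sum_ks_apply_eq_mk_iff (x := ω) (y := ⟨y, hy⟩)).1 ?_⟩
  refine congr($ha ω).trans ?_
  rw [LinearMap.comp_apply, hcoord, LinearMap.toSpanSingleton_apply, one_smul,
    Submodule.mkQ_apply]

/-- The derivatives of a generator of `Fil³ H` are independent modulo `Fil³ H`. -/
theorem HodgeFCrystal.KodairaSpencerIso.eq_zero (hKS : X.KodairaSpencerIso) {ω₀ : H}
    (hω₀ : Submodule.span (PS p k h) {ω₀} = X.Fil 3) {a : Fin h → PS p k h}
    (ha : ∑ j, a j • X.D j ω₀ ∈ X.Fil 3) : a = 0 := by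
  have hmem : ω₀ ∈ X.Fil 3 := hω₀ ▸ Submodule.mem_span_singleton_self ω₀
  have hz : (∑ j, a j • X.ks j) ⟨ω₀, hmem⟩ = 0 := by
    rw [← Submodule.Quotient.mk_zero, X.sum_ks_apply_eq_mk_iff]
    simpa using ha
  refine hKS.1 ?_
  have : ∑ j, a j • X.ks j = 0 := by
    ext x
    obtain ⟨x, hx⟩ := x
    obtain ⟨c, rfl⟩ := Submodule.mem_span_singleton.1 (hω₀ ▸ hx)
    have : (⟨c • ω₀, hx⟩ : X.Fil 3) = c • ⟨ω₀, hmem⟩ := rfl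
    rw [this, map_smul, hz, smul_zero, LinearMap.zero_apply]
  simpa using this

/-- The Jacobian matrix of `τ₂₃` is invertible. -/
theorem IsStructureBasis.isUnit_det_jacobian [CharP k p] (he : IsStructureBasis X U B Xb e T)
    (hKS : X.KodairaSpencerIso) (hXb : X.toFCrystal.IsBaseChange Xb) {ω₀ : H}
    (hω₀ : Submodule.span (PS p k h) {ω₀} = X.Fil 3) {f : (PS p kb h)ˣ}
    (hf : 1 ⊗ₜ[PS p k h] ω₀ = (f : PS p kb h) • e i3) {J : Matrix (Fin h) (Fin h) (PS p kb h)}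
    (hJ : ∀ j, Xb.D j (e i3) = ∑ m, J m j • e (i2 m)) : IsUnit J.det := by
  have h0 : ω₀ ≠ 0 := by
    rintro rfl
    rw [TensorProduct.tmul_zero, eq_comm, f.isUnit.smul_eq_zero] at hf
    exact e.ne_zero _ hf
  -- The block 2 coordinates of `Fil²` lie in the column space of `J`, because modulo `e i3` the
  -- derivative `D_j ω₀` is `f D_j (e i3)`; hence the factor `f` in the witness below. Applied to
  -- the `e (i2 m)`, this yields a right inverse of `J`.
  have hspan : ∀ z ∈ (X.Fil 2).baseChange (PS p kb h),
      ∃ a : Fin h → PS p kb h, ∀ m, e.repr z (i2 m) = ∑ j, J m j * a j := by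
    intro z hz
    rw [Submodule.baseChange_eq_span] at hz
    induction hz using Submodule.span_induction with
    | mem z hz =>
      obtain ⟨y, hy, rfl⟩ := hz
      obtain ⟨a, ha⟩ := hKS.exists_sum hω₀ h0 hy
      rw [← hω₀, Submodule.mem_span_singleton] at ha
      obtain ⟨c, hc⟩ := ha
      rw [eq_comm, sub_eq_iff_eq_add] at hc
      have hs : ∀ (r : PS p k h) (v : PS p kb h ⊗[PS p k h] H),
          r • v = algebraMap (PS p k h) (PS p kb h) r • v := fun r v => (algebraMap_smul _ r v).symm
      refine ⟨fun j => f * algebraMap _ _ (a j), fun m => ?_⟩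
      rw [hc]
      simp only [TensorProduct.mk_apply, TensorProduct.tmul_add, TensorProduct.tmul_smul,
        TensorProduct.tmul_sum, ← hXb.D_eq, hf, Xb.leibniz, hJ, hs]
      simp [i2, i3, Finsupp.single_apply, mul_assoc, mul_comm, mul_left_comm,
        -algebraMap_smul]
    | zero => exact ⟨0, by simp⟩
    | add x y _ _ hx hy =>
      obtain ⟨a, ha⟩ := hx
      obtain ⟨b, hb⟩ := hy
      exact ⟨a + b, fun m => by simp [ha, hb, mul_add, Finset.sum_add_distrib]⟩
    | smul c x _ hx =>
      obtain ⟨a, ha⟩ := hx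
      exact ⟨c • a, fun m => by simp [ha, Finset.mul_sum, mul_left_comm]⟩
  choose a ha using fun m => hspan _ (he.mem (i2 m)).2
  refine isUnit_det_of_right_inverse (B := of fun j m => a m j) ?_
  refine Matrix.ext fun i m => ?_
  rw [mul_apply, one_apply]
  simpa [i2, Finsupp.single_apply, eq_comm] using (ha m i).symm

/-- The element of `H⁰` dual to `-ω₀` is `f⁻¹ e_0`. -/
theorem IsStructureBasis.tmul_piece_zero (he : IsStructureBasis X U B Xb e T) {ρ : H →ₗ[PS p k h] H}
    (hρ : ∀ c, ρ.baseChange (PS p kb h) (e c) = if deg c = 0 then e c else 0)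
    {ω₀ : H} {f : (PS p kb h)ˣ} (hf : 1 ⊗ₜ[PS p k h] ω₀ = (f : PS p kb h) • e i3) {z : H}
    (hz : B z ω₀ = -1) : 1 ⊗ₜ[PS p k h] ρ z = (↑f⁻¹ : PS p kb h) • e i0 := by
  have h1 : (f : PS p kb h) * e.repr (1 ⊗ₜ[PS p k h] z) i0 = 1 := by
    have h2 : LinearMap.BilinForm.baseChange (PS p kb h) B (1 ⊗ₜ z) (1 ⊗ₜ ω₀) = -1 := by
      simp [hz]
    rw [hf, map_smul, bilin_apply_i3 he.gram_eq] at h2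
    simpa using h2
  have h3 : e.repr (1 ⊗ₜ[PS p k h] z) i0 = ↑f⁻¹ := Units.eq_inv_of_mul_eq_one_right ((mul_comm _ _).trans h1)
  rw [← LinearMap.baseChange_tmul, ← h3]
  conv_lhs => rw [← e.sum_repr (1 ⊗ₜ[PS p k h] z)]
  simp only [map_sum, map_smul, hρ]
  simp [Fintype.sum_sum_type, deg, i0]

/-- The elements of `H¹` dual to `ω_1, …, ω_h`. -/
theorem IsStructureBasis.tmul_piece_one (he : IsStructureBasis X U B Xb e T) {ρ : H →ₗ[PS p k h] H}
    (hρ : ∀ c, ρ.baseChange (PS p kb h) (e c) = if deg c = 1 then e c else 0)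
    {f : (PS p kb h)ˣ} {J : Matrix (Fin h) (Fin h) (PS p kb h)} (hJ : IsUnit J.det)
    {ω : Fin h → H}
    (hω : ∀ j, 1 ⊗ₜ[PS p k h] ω j = (f : PS p kb h) • ∑ m, J m j • e (i2 m)) {z : H} {i : Fin h}
    (hz : ∀ j, B z (ω j) = if i = j then 1 else 0) :
    1 ⊗ₜ[PS p k h] ρ z = ∑ m, ((↑f⁻¹ : PS p kb h) * J⁻¹ i m) • e (i1 m) := by
  let u : Fin h → PS p kb h := fun m => e.repr (1 ⊗ₜ[PS p k h] z) (i1 m)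
  -- Through the Gram matrix, duality with the `ω j` becomes a linear system for the block 1
  -- coordinates `u`.
  have h1 : (f : PS p kb h) • (u ᵥ* J) = Pi.single i 1 := by
    ext1 j
    have h2 : LinearMap.BilinForm.baseChange (PS p kb h) B (1 ⊗ₜ z) (1 ⊗ₜ ω j)
        = if i = j then 1 else 0 := by
      simp [hz]
    simp only [hω, map_smul, map_sum, bilin_apply_i2 he.gram_eq] at h2
    simpa [vecMul, dotProduct, u, mul_comm, Pi.single_apply, eq_comm] using h2
  have h3 : u = (↑f⁻¹ : PS p kb h) • (Pi.single i 1 ᵥ* J⁻¹) := by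
    rw [← h1, smul_vecMul, vecMul_vecMul, mul_nonsing_inv _ hJ, vecMul_one, smul_smul,
      Units.inv_mul, one_smul]
  have h4 : ∀ m, e.repr (1 ⊗ₜ[PS p k h] z) (i1 m) = ↑f⁻¹ * J⁻¹ i m := fun m => by
    simpa [u] using congr($h3 m)
  simp only [← h4]
  rw [← LinearMap.baseChange_tmul]
  conv_lhs => rw [← e.sum_repr (1 ⊗ₜ[PS p k h] z)]
  simp only [map_sum, map_smul, hρ]
  simp [Fintype.sum_sum_type, deg, i1]

end Structure

end CY3

/-! ### Descent of the normalised basis to `H`. -/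

theorem proposition3p2 {p : ℕ} [Fact p.Prime] (hp : 3 < p)
    {k : Type*} [Field k] [CharP k p] [PerfectRing k p]
    {kb : Type*} [Field kb] [CharP kb p] [Algebra k kb] [IsAlgClosed kb] [Algebra.IsAlgebraic k kb]
    {h : ℕ} {H : Type*} [AddCommGroup H] [Module (CY3.PS p k h) H]
    (X : CY3.HodgeFCrystal p k h H) (U : ℕ → Submodule (CY3.PS p k h) H)
    (B : LinearMap.BilinForm (CY3.PS p k h) H)
    (hX : X.IsOrdinaryCY3 U B h) (hKS : X.KodairaSpencerIso)
    (Xb : CY3.FCrystal p kb h (CY3.PS p kb h ⊗[CY3.PS p k h] H))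
    (hXb : X.toFCrystal.IsBaseChange Xb)
    (e : Module.Basis (CY3.Idx h) (CY3.PS p kb h) (CY3.PS p kb h ⊗[CY3.PS p k h] H))
    (Z : CY3.KPS p kb h) (τ₂₃ τ₁₃ : Fin h → CY3.KPS p kb h)
    (τ₁₂ : Matrix (Fin h) (Fin h) (CY3.KPS p kb h))
    (he : CY3.IsStructureBasis X U B Xb e (CY3.Tmat Z τ₂₃ τ₁₃ τ₁₂))
    (ω₀ : H) (hω₀ : Submodule.span (CY3.PS p k h) {ω₀} = X.Fil 3) :
    -- the unit `f` with `ω₀ = f e_{2h+1}`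
    ∃ f : (CY3.PS p kb h)ˣ, 1 ⊗ₜ[CY3.PS p k h] ω₀ = (f : CY3.PS p kb h) • e CY3.i3 ∧
    -- the Jacobian matrix `J = (∂τ_i/∂t_j)` has entries in `Ā` and is invertible over `Ā`
    ∃ J : Matrix (Fin h) (Fin h) (CY3.PS p kb h),
      (∀ i j, CY3.toKPS p kb h (J i j) = CY3.dK p kb h j (τ₂₃ i)) ∧ IsUnit J.det ∧
    -- the elements `ω̌_c` lie in `H` and form a basis
    ∃ b : Module.Basis (CY3.Idx h) (CY3.PS p k h) H,
      (1 ⊗ₜ[CY3.PS p k h] b CY3.i0 = (↑f⁻¹ : CY3.PS p kb h) • e CY3.i0) ∧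
      (∀ i, 1 ⊗ₜ[CY3.PS p k h] b (CY3.i1 i)
        = ∑ m, ((↑f⁻¹ : CY3.PS p kb h) * J⁻¹ i m) • e (CY3.i1 m)) ∧
      (∀ j, 1 ⊗ₜ[CY3.PS p k h] b (CY3.i2 j)
        = (f : CY3.PS p kb h) •
          Xb.D j ((↑f⁻¹ : CY3.PS p kb h) • (1 ⊗ₜ[CY3.PS p k h] ω₀))) ∧
      b CY3.i3 = ω₀ ∧
      (∀ c, b c ∈ X.piece U (CY3.deg c)) ∧
      e.toMatrix (fun c => 1 ⊗ₜ[CY3.PS p k h] b c) = CY3.Smat f J := by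
  obtain ⟨f, hf⟩ := he.exists_unit hω₀
  have hω₀3 : ω₀ ∈ X.Fil 3 := hω₀ ▸ Submodule.mem_span_singleton_self ω₀
  obtain ⟨J, hJτ, hJ⟩ := he.exists_jacobian hX hXb hω₀3 hf
  have hJdet := he.isUnit_det_jacobian hKS hXb hω₀ hf hJ
  have := X.free
  have := X.finite
  choose ρ hρmem hρsub hρzero hρbar using CY3.exists_piece_projection (R' := CY3.PS p kb h)
    hX.filtration.mono X.Fil_anti X.Fil_zero hX.isCompl
  have hρe : ∀ i c, (ρ i).baseChange (CY3.PS p kb h) (e c) = if CY3.deg c = i then e c else 0 :=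
    fun i c => hρbar i _ _ (he.mem c)
  -- The difference `x - ρ i x` lies in `U i ∩ Fil (i + 1) = 0`.
  have hρid : ∀ i, ∀ x ∈ X.piece U i, ρ i x = x := fun i x hx =>
    (sub_eq_zero.1 (Submodule.disjoint_def.1 (hX.isCompl i).disjoint _
      (sub_mem hx.1 (hρmem i x).1) (hρsub i x hx.2))).symm
  have he3 : e CY3.i3 = (↑f⁻¹ : CY3.PS p kb h) • (1 ⊗ₜ[CY3.PS p k h] ω₀) := by
    rw [hf, smul_smul, Units.inv_mul, one_smul]
  have h0 : ω₀ ≠ 0 := by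
    rintro rfl
    rw [TensorProduct.tmul_zero, smul_zero] at he3
    exact e.ne_zero _ he3
  have hω₀piece : ω₀ ∈ X.piece U 3 := ⟨hX.U_three ▸ trivial, hω₀3⟩
  -- Projecting removes the term `(∂f/∂t_j) e i3` of `D_j (f e i3)`, which leaves `f D_j (f⁻¹ ω₀)`,
  -- now visibly in `H`.
  let ω : Fin h → H := fun j => ρ 2 (X.D j ω₀)
  have hω : ∀ j, 1 ⊗ₜ[CY3.PS p k h] ω j = (f : CY3.PS p kb h) • ∑ m, J m j • e (CY3.i2 m) := by
    intro j
    rw [← LinearMap.baseChange_tmul, ← hXb.D_eq, hf, Xb.leibniz, hJ]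
    simp only [map_add, map_smul, map_sum, hρe]
    simp [CY3.deg, CY3.i2, CY3.i3]
  have hωsum : ∀ a : Fin h → CY3.PS p k h, ∑ j, a j • ω j = ρ 2 (∑ j, a j • X.D j ω₀) := by
    intro a
    simp [ω]
  -- A relation puts `∑ a_j D_j ω₀` in `Fil³`, against injectivity of Kodaira–Spencer.
  have hωli : LinearIndependent (CY3.PS p k h) ω := by
    refine Fintype.linearIndependent_iff.2 fun a ha => congrFun (hKS.eq_zero hω₀ ?_)
    rw [hωsum] at ha
    have := hρsub 2 (∑ j, a j • X.D j ω₀)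
      (sum_mem fun j _ => Submodule.smul_mem _ _ (X.griffiths 2 j _ hω₀3))
    rwa [ha, sub_zero] at this
  have hωspan : ∀ x, ρ 2 x ∈ Submodule.span (CY3.PS p k h) (Set.range ω) := by
    intro x
    obtain ⟨a, ha⟩ := hKS.exists_sum hω₀ h0 (hρmem 2 x).2
    have h2 := hρzero 2 _ ha
    rw [map_sub, hρid 2 _ (hρmem 2 x), ← hωsum, sub_eq_zero] at h2
    rw [h2]
    exact sum_mem fun j _ => Submodule.smul_mem _ _ (Submodule.subset_span ⟨j, rfl⟩)
  obtain ⟨ℓ, hℓ⟩ := CY3.exists_dual_family hωli (ρ 2) hωspan fun j => hρid 2 _ (hρmem 2 _)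
  have : IsDomain (CY3.PS p k h) := NoZeroDivisors.to_isDomain _
  obtain ⟨ℓ₀, hℓ₀⟩ := CY3.exists_dual_family (R := CY3.PS p k h) (v := fun _ : Unit => ω₀)
    (LinearIndependent.of_subsingleton () h0) (ρ 3)
    (fun x => by simpa [hω₀] using (hρmem 3 x).2) fun _ => hρid 3 _ hω₀piece
  choose z hz using fun i => hX.perfect.2 (ℓ i)
  -- The sign compensates the entry `-1` of the Gram matrix.
  obtain ⟨z₀, hz₀⟩ := hX.perfect.2 (-ℓ₀ ())
  have hb0 := he.tmul_piece_zero (hρe 0) hf (z := z₀) (by rw [hz₀, LinearMap.neg_apply, hℓ₀ () (), if_pos rfl])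
  have hb1 := fun i => he.tmul_piece_one (hρe 1) hJdet hω (z := z i) (i := i)
    (by simp [hz, hℓ])
  let b : CY3.Idx h → H :=
    Sum.elim (Sum.elim (fun _ => ρ 0 z₀) fun i => ρ 1 (z i)) (Sum.elim ω fun _ => ω₀)
  have hS : e.toMatrix (fun c => 1 ⊗ₜ[CY3.PS p k h] b c) = CY3.Smat f J := by
    refine Matrix.ext fun r c => ?_
    rw [Module.Basis.toMatrix_apply]
    rcases c with (c | c) | (c | c) <;> rcases r with (r | r) | (r | r) <;>
      simp [b, hb0, hb1, hω, hf, CY3.Smat, CY3.i0, CY3.i1, CY3.i2, CY3.i3, Finsupp.single_apply]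
  have := CY3.isLocalHom_algebraMap (p := p) (k := k) (kb := kb) (n := h)
  obtain ⟨b', hb'⟩ := CY3.exists_basis_of_baseChange e b
    (hS ▸ CY3.isUnit_det_Smat f hJdet)
  refine ⟨f, hf, J, hJτ, hJdet, b', ?_⟩
  rw [hb']
  refine ⟨hb0, hb1, fun j => ?_, rfl, ?_, hS⟩
  · rw [← he3, hJ]
    exact hω j
  · rintro ((c | c) | (c | c))
    exacts [hρmem 0 _, hρmem 1 _, hρmem 2 _, hω₀piece]
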